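/- Let $q$ be a prime power, let $m,n,k$ be positive integers with $k<n\le m$, and let $s\in\{1,\dots,m-1\}$ with $\gcd(s,m)=1$. Let $\mathcal C\subseteq\mathbb F_{q^m}^n$ be an MRD code of dimension $k$, that is, an $\mathbb F_{q^m}$-linear subspace of dimension $k$ whose minimum rank distance is $d=n-k+1$, where the rank distance of $v,w\in\mathbb F_{q^m}^n$ is $\dim_{\mathbb F_q}\langle v_1-w_1,\dots,v_n-w_n\rangle_{\mathbb F_q}$. Assume that $\mathcal C$ has the generator matrix $G=[\,I_k\mid X\,]$ with $X\in\mathbb F_{q^m}^{k\times(n-k)}$ (the rows of $G$ form a basis of $\mathcal C$). Let $\mathcal U_G\subseteq\mathbb F_{q^m}^k$ be the $\mathbb F_q$-span of the columns of $G$, let $$L_{\mathcal U_G}=\{\langle u\rangle_{\mathbb F_{q^m}} : u\in\mathcal U_G\setminus\{0\}\}\subseteq \mathrm{PG}(k-1,q^m)$$ be the associated linear set, let $\mathcal I(L_{\mathcal U_G})\subseteq\mathbb F_{q^m}[x_1,\dots,x_k]$ be its homogeneous vanishing ideal (generated by the homogeneous polynomials that vanish at all its points), and let $$\mathcal F_s=\big\langle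 x_i^{q^s}x_j-x_ix_j^{q^s} : 1\le i<j\le k\big\rangle_{\mathbb F_{q^m}}.$$ Call $\mathcal C$ a generalized Gabidulin code with parameter $s$ if there are $\alpha_1,\dots,\alpha_n\in\mathbb F_{q^m}$, linearly independent over $\mathbb F_q$, such that the $k\times n$ matrix with entries $\alpha_j^{q^{s(i-1)}}$ ($1\le i\le k$, $1\le j\le n$) is a generator matrix of $\mathcal C$. If $\mathcal C$ is a generalized Gabidulin code with parameter $s$, then $$\dim_{\mathbb F_{q^m}}\big(\mathcal F_s\cap\mathcal I(L_{\mathcal U_G})\big)=\binom{k-1}{2}.$$ Conversely, if $k\neq 2$ and this equality holds, then $\mathcal C$ is a generalized Gabidulin code with parameter $s$. (So for $k\neq2$ the two conditions are equivalent.) -/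

import Mathlib

noncomputable section

namespace RankMetric

variable (K : Type*) {L : Type*} [Field K] [Field L] [Algebra K L]

/-- The rank distance on `Lⁿ`: the `K`-dimension of the span of the entries of `v - w`. -/
def rankDist {n : ℕ} (v w : Fin n → L) : ℕ :=
  Module.finrank K (Submodule.span K (Set.range fun j => v j - w j))

/-- The minimum rank distance of a linear code. -/
def minRankDist {n : ℕ} (C : Submodule L (Fin n → L)) : ℕ :=
  sInf {d : ℕ | ∃ v ∈ C, ∃ w ∈ C, v ≠ w ∧ rankDist K v w = d}

/-- A maximum rank distance code: `n ≤ m = [L : K]`, and the Singleton-like bound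
`k ≤ n - d + 1` holds with equality (written `k + d = n + 1`, without subtraction). -/
def IsMRD {n : ℕ} (C : Submodule L (Fin n → L)) : Prop :=
  n ≤ Module.finrank K L ∧ Module.finrank L C + minRankDist K C = n + 1

/-- `G` is a generator matrix of `C`: its rows form a basis of `C`. -/
def IsGeneratorMatrix {k n : ℕ} (G : Matrix (Fin k) (Fin n) L)
    (C : Submodule L (Fin n → L)) : Prop :=
  LinearIndependent L (fun i => G i) ∧ Submodule.span L (Set.range fun i => G i) = C

/-- The matrix in systematic form `[I_k | X]`. -/
def systematicMatrix {k n : ℕ} (hkn : k ≤ n) (X : Matrix (Fin k) (Fin (n - k)) L) :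
    Matrix (Fin k) (Fin n) L :=
  (Matrix.fromCols (1 : Matrix (Fin k) (Fin k) L) X).submatrix id
    (fun j => finSumFinEquiv.symm (Fin.cast (Nat.add_sub_of_le hkn).symm j))

/-- The matrix with rows `α, α^[s], …, α^[s(k-1)]`, where `[i] = q ^ i` and `q = |K|`. -/
def gabidulinMatrix {n : ℕ} (s k : ℕ) (α : Fin n → L) : Matrix (Fin k) (Fin n) L :=
  Matrix.of fun i j => α j ^ (Nat.card K ^ (s * (i : ℕ)))

/-- `C` is a generalized Gabidulin code with parameter `s` and of dimension `k`. -/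
def IsGeneralizedGabidulin {n : ℕ} (s k : ℕ) (C : Submodule L (Fin n → L)) : Prop :=
  Nat.gcd s (Module.finrank K L) = 1 ∧
    ∃ α : Fin n → L, LinearIndependent K α ∧ IsGeneratorMatrix (gabidulinMatrix K s k α) C

/-- The `K`-span `U_G` of the columns of `G`. -/
def columnSystem {k n : ℕ} (G : Matrix (Fin k) (Fin n) L) : Submodule K (Fin k → L) :=
  Submodule.span K (Set.range fun j => fun i => G i j)

/-- The linear set `L_U = {⟨u⟩ : u ∈ U, u ≠ 0}` in the projective space `PG(k-1, L)`. -/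
def linearSet {k : ℕ} (U : Submodule K (Fin k → L)) :
    Set (Projectivization L (Fin k → L)) :=
  {P | ∃ u ∈ U, ∃ hu : u ≠ 0, P = Projectivization.mk L u hu}

/-- The (homogeneous) vanishing ideal of a set of projective points: the ideal generated by
the homogeneous polynomials that vanish at all points of the set. -/
def vanishingIdeal {k : ℕ} (V : Set (Projectivization L (Fin k → L))) :
    Ideal (MvPolynomial (Fin k) L) :=
  Ideal.span {p | (∃ d : ℕ, p.IsHomogeneous d) ∧
    ∀ (v : Fin k → L) (hv : v ≠ 0), Projectivization.mk L v hv ∈ V → MvPolynomial.eval v p = 0}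

/-- The space `F_s`, the `L`-span of the forms `x_i^[s] x_j - x_i x_j^[s]` with `i < j`. -/
def formSpace (L : Type*) [Field L] (k s : ℕ) : Submodule L (MvPolynomial (Fin k) L) :=
  Submodule.span L {p | ∃ i j : Fin k, i < j ∧
    p = MvPolynomial.X i ^ (Nat.card K ^ s) * MvPolynomial.X j
      - MvPolynomial.X i * MvPolynomial.X j ^ (Nat.card K ^ s)}

end RankMetric

end

/-! Let `σ` be the `q^s`-power map. Alternating forms `ω` on `L^k` correspond bijectively to
elements of `F_s`, through `u ↦ ω(σ(u), u)`. Since `U_G` contains the unit vectors, polarization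
shows that this polynomial vanishes on `L_{U_G}` exactly when the radical of `ω` contains the span
`D` of all `w - σ(w)`, `w ∈ U_G`. Hence the dimension is `choose (k - dim D) 2`
(`finrank_formSpace_inf_vanishingIdeal`). The MRD property gives `D ≠ 0`: otherwise `G` has entries
in `K` and the code has words of rank one. For `k ≠ 2` the equality therefore says `dim D = 1`, and
it remains to match this with the Gabidulin property. The link is `σ(φ)G - σ(φG) = σ(φ)·(G - σ(G))`.
If `α = φG` and its conjugates lie in `C`, then `σ(φ), …, σ^(k-1)(φ)` annihilate `D`
(`finrank_deviationSpace_le_one`). If `D` is spanned by `c`, some `φ ≠ 0` has these `k - 1`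
conjugates orthogonal to `c`, and `α = φG` generates `C` (`IsMRD.isGeneralizedGabidulin`). -/

namespace RankMetric

open MvPolynomial

/-! ### Alternating bilinear forms and their radicals. -/

section AlternatingForms

variable {L : Type*} [Field L] {k : ℕ}

/-- The `2 × 2` minor in the coordinates `i` and `j`, as an alternating form. -/
noncomputable def minorForm (i j : Fin k) : (Fin k → L) [⋀^Fin 2]→ₗ[L] L :=
  (Matrix.detRowAlternating (n := Fin 2) (R := L)).compLinearMap (LinearMap.funLeft L L ![i, j])

theorem minorForm_apply (i j : Fin k) (x y : Fin k → L) :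
    minorForm i j ![x, y] = x i * y j - x j * y i := by
  have h : minorForm i j ![x, y] =
      Matrix.det (Matrix.of fun a b : Fin 2 => (![x, y] a) (![i, j] b)) := rfl
  rw [h, Matrix.det_fin_two]
  simp

theorem alternating_sum_apply {ι : Type*} (t : Finset ι)
    (f : ι → (Fin k → L) [⋀^Fin 2]→ₗ[L] L) (v : Fin 2 → Fin k → L) :
    (∑ i ∈ t, f i) v = ∑ i ∈ t, f i v := by
  classical
  induction t using Finset.induction_on with
  | empty => rfl
  | insert a t ha ih => rw [Finset.sum_insert ha, Finset.sum_insert ha, AlternatingMap.add_apply, ih]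

theorem alternating_two_swap (ω : (Fin k → L) [⋀^Fin 2]→ₗ[L] L) (x y : Fin k → L) :
    ω ![x, y] = -ω ![y, x] := by
  have h := ω.map_swap ![y, x] (i := 0) (j := 1) (by decide)
  rw [← h]
  congr 1
  ext a : 1
  fin_cases a <;> simp

theorem alternating_two_self (ω : (Fin k → L) [⋀^Fin 2]→ₗ[L] L) (x : Fin k → L) :
    ω ![x, x] = 0 :=
  ω.map_eq_zero_of_eq ![x, x] (i := 0) (j := 1) (by simp) (by decide)

theorem alternating_two_add_left (ω : (Fin k → L) [⋀^Fin 2]→ₗ[L] L) (x x' y : Fin k → L) :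
    ω ![x + x', y] = ω ![x, y] + ω ![x', y] :=
  ω.toMultilinearMap.cons_add ![y] x x'

theorem alternating_two_smul_left (ω : (Fin k → L) [⋀^Fin 2]→ₗ[L] L) (c : L)
    (x y : Fin k → L) : ω ![c • x, y] = c * ω ![x, y] :=
  ω.toMultilinearMap.cons_smul ![y] c x

theorem alternating_two_add_right (ω : (Fin k → L) [⋀^Fin 2]→ₗ[L] L) (x y y' : Fin k → L) :
    ω ![x, y + y'] = ω ![x, y] + ω ![x, y'] := by
  rw [alternating_two_swap ω x, alternating_two_add_left, alternating_two_swap ω y,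
    alternating_two_swap ω y']
  ring

theorem alternating_two_smul_right (ω : (Fin k → L) [⋀^Fin 2]→ₗ[L] L) (c : L)
    (x y : Fin k → L) : ω ![x, c • y] = c * ω ![x, y] := by
  rw [alternating_two_swap ω x, alternating_two_smul_left, alternating_two_swap ω y]
  ring

theorem alternating_two_sub_left (ω : (Fin k → L) [⋀^Fin 2]→ₗ[L] L) (x x' y : Fin k → L) :
    ω ![x - x', y] = ω ![x, y] - ω ![x', y] := by
  rw [eq_sub_iff_add_eq, ← alternating_two_add_left, sub_add_cancel]

/-- The alternating linear map of a form in the first variable. -/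
def formLeft (ω : (Fin k → L) [⋀^Fin 2]→ₗ[L] L) (y : Fin k → L) : (Fin k → L) →ₗ[L] L where
  toFun x := ω ![x, y]
  map_add' x x' := alternating_two_add_left ω x x' y
  map_smul' c x := alternating_two_smul_left ω c x y

/-- The linear map of an alternating form in the second variable. -/
def formRight (ω : (Fin k → L) [⋀^Fin 2]→ₗ[L] L) (x : Fin k → L) : (Fin k → L) →ₗ[L] L where
  toFun y := ω ![x, y]
  map_add' y y' := alternating_two_add_right ω x y y'
  map_smul' c y := alternating_two_smul_right ω c x y

/-- The alternating forms whose radical contains `D`. -/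
def formsWithRadical (D : Submodule L (Fin k → L)) :
    Submodule L ((Fin k → L) [⋀^Fin 2]→ₗ[L] L) where
  carrier := {ω | ∀ d ∈ D, ∀ x, ω ![d, x] = 0}
  add_mem' := by
    intro ω ω' h h' d hd x
    rw [AlternatingMap.add_apply, h d hd, h' d hd, add_zero]
  zero_mem' := fun _ _ _ => rfl
  smul_mem' := by
    intro c ω h d hd x
    rw [AlternatingMap.smul_apply, h d hd, smul_zero]

theorem finrank_alternating_two (V : Type*) [AddCommGroup V] [Module L V]
    [Module.Finite L V] :
    Module.finrank L (V [⋀^Fin 2]→ₗ[L] L) = Nat.choose (Module.finrank L V) 2 := by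
  rw [(exteriorPower.alternatingMapLinearEquiv (R := L) (M := V) (N := L) (n := 2)).finrank_eq,
    ← exteriorPower.finrank_eq (R := L) (M := V) (n := 2)]
  exact Subspace.dual_finrank_eq

/-- These forms are exactly the pullbacks of the alternating forms on the quotient by `D`. -/
theorem finrank_formsWithRadical (D : Submodule L (Fin k → L)) :
    Module.finrank L (formsWithRadical D) = Nat.choose (k - Module.finrank L D) 2 := by
  let Φ : (((Fin k → L) ⧸ D) [⋀^Fin 2]→ₗ[L] L) →ₗ[L] ((Fin k → L) [⋀^Fin 2]→ₗ[L] L) :=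
    { toFun := fun ω => ω.compLinearMap D.mkQ
      map_add' := fun _ _ => rfl
      map_smul' := fun _ _ => rfl }
  have hinj : Function.Injective Φ := by
    intro ω ω' h
    exact AlternatingMap.compLinearMap_injective D.mkQ D.mkQ_surjective h
  have hrange : LinearMap.range Φ = formsWithRadical D := by
    apply le_antisymm
    · rintro _ ⟨ω, rfl⟩ d hd x
      refine ω.map_coord_zero (0 : Fin 2) ?_
      simpa using hd
    · intro ω hω
      -- A linear section `f` of the quotient map descends `ω`: replacing `x` by `f (D.mkQ x)`
      -- changes it only by an element of the radical.
      obtain ⟨f, hf⟩ := D.mkQ.exists_rightInverse_of_surjective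
        (LinearMap.range_eq_top.2 D.mkQ_surjective)
      have hdiff : ∀ x, x - f (D.mkQ x) ∈ D := by
        intro x
        refine (Submodule.Quotient.eq D).1 ?_
        exact (LinearMap.congr_fun hf (D.mkQ x)).symm
      have hfirst : ∀ x y, ω ![f (D.mkQ x), y] = ω ![x, y] := by
        intro x y
        have := hω _ (hdiff x) y
        rw [alternating_two_sub_left, sub_eq_zero] at this
        exact this.symm
      refine ⟨ω.compLinearMap f, ?_⟩
      ext v
      have hv : v = ![v 0, v 1] := by
        ext a : 1
        fin_cases a <;> rfl
      have hv' : (fun a => f (D.mkQ (v a))) = ![f (D.mkQ (v 0)), f (D.mkQ (v 1))] := by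
        ext a : 1
        fin_cases a <;> rfl
      change ω (fun a => f (D.mkQ (v a))) = ω v
      rw [hv', hfirst, alternating_two_swap, hfirst, ← alternating_two_swap, ← hv]
  rw [← hrange, LinearMap.finrank_range_of_inj hinj, finrank_alternating_two,
    Submodule.finrank_quotient, Module.finrank_fin_fun]

theorem alternating_two_expand (ω : (Fin k → L) [⋀^Fin 2]→ₗ[L] L) :
    ω = ∑ p : Fin k × Fin k with p.1 < p.2,
      ω ![Pi.single p.1 1, Pi.single p.2 1] • minorForm p.1 p.2 := by
  have key : ∀ a b : Fin k, a < b → ω ![Pi.single a 1, Pi.single b 1] =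
      (∑ p : Fin k × Fin k with p.1 < p.2,
        ω ![Pi.single p.1 1, Pi.single p.2 1] • minorForm p.1 p.2)
          ![Pi.single a 1, Pi.single b 1] := by
    intro a b hab
    rw [alternating_sum_apply, Finset.sum_eq_single (a, b)]
    · simp [minorForm_apply, hab.ne, hab.ne']
    · rintro ⟨i, j⟩ hij hne
      have hij' : i < j := by simpa using hij
      rw [AlternatingMap.smul_apply, minorForm_apply]
      simp only [Pi.single_apply]
      have h1 : ¬ (i = a ∧ j = b) := fun h => hne (by rw [h.1, h.2])
      have h2 : ¬ (j = a ∧ i = b) := by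
        rintro ⟨rfl, rfl⟩
        exact lt_asymm hab hij'
      by_cases hia : i = a <;> by_cases hjb : j = b <;> by_cases hja : j = a <;>
        by_cases hib : i = b <;> simp_all
    · intro h
      exact absurd (by simpa using hab) h
  refine Module.Basis.ext_alternating (Pi.basisFun L (Fin k)) ?_
  intro v hv
  have hv' : (fun i => (Pi.basisFun L (Fin k)) (v i)) =
      ![Pi.single (v 0) 1, Pi.single (v 1) 1] := by
    ext a : 1
    fin_cases a <;> simp
  rw [hv']
  rcases lt_trichotomy (v 0) (v 1) with h | h | h
  · exact key _ _ h
  · exact absurd (hv h) (by decide)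
  · rw [alternating_two_swap ω, alternating_two_swap (Finset.sum _ _), key _ _ h]

end AlternatingForms

/-! ### The isomorphism between alternating forms and `F_s`. -/

section Polynomials

variable {L : Type*} [Field L] {k : ℕ}

/-- The polynomial `∑_{i<j} ω(e_i, e_j) (x_i^q x_j - x_i x_j^q)` of an alternating form `ω`. -/
noncomputable def formPoly (L : Type*) [Field L] (k q : ℕ) :
    ((Fin k → L) [⋀^Fin 2]→ₗ[L] L) →ₗ[L] MvPolynomial (Fin k) L where
  toFun ω := ∑ p : Fin k × Fin k with p.1 < p.2,
    ω ![Pi.single p.1 1, Pi.single p.2 1] • (X p.1 ^ q * X p.2 - X p.1 * X p.2 ^ q)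
  map_add' ω ω' := by
    simp only [AlternatingMap.add_apply, add_smul, Finset.sum_add_distrib]
  map_smul' c ω := by
    simp only [AlternatingMap.smul_apply, smul_assoc, Finset.smul_sum, RingHom.id_apply]

theorem formPoly_apply (q : ℕ) (ω : (Fin k → L) [⋀^Fin 2]→ₗ[L] L) :
    formPoly L k q ω = ∑ p : Fin k × Fin k with p.1 < p.2,
      ω ![Pi.single p.1 1, Pi.single p.2 1] • (X p.1 ^ q * X p.2 - X p.1 * X p.2 ^ q) := rfl

theorem eval_formPoly (q : ℕ) (ω : (Fin k → L) [⋀^Fin 2]→ₗ[L] L) (u : Fin k → L) :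
    eval u (formPoly L k q ω) = ω ![fun i => u i ^ q, u] := by
  conv_rhs => rw [alternating_two_expand ω]
  rw [formPoly_apply, map_sum, alternating_sum_apply]
  refine Finset.sum_congr rfl fun p _ => ?_
  rw [AlternatingMap.smul_apply, minorForm_apply, smul_eval]
  simp [mul_comm]

theorem isHomogeneous_formPoly (q : ℕ) (ω : (Fin k → L) [⋀^Fin 2]→ₗ[L] L) :
    (formPoly L k q ω).IsHomogeneous (q + 1) := by
  rw [formPoly_apply]
  refine IsHomogeneous.sum _ _ _ fun p _ => ?_
  rw [smul_eq_C_mul]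
  refine IsHomogeneous.C_mul (IsHomogeneous.sub ?_ ?_) _
  · simpa using (((isHomogeneous_X L p.1).pow q).mul (isHomogeneous_X L p.2))
  · simpa [add_comm] using ((isHomogeneous_X L p.1).mul ((isHomogeneous_X L p.2).pow q))

/-- As `q ≠ 1`, the exponents tell the two variables apart, so `x_i^q x_j` and `x_i x_j^q` are
different monomials. This lets the coefficients of `ω` be read off from its polynomial. -/
theorem coeff_X_pow_mul_X {q : ℕ} (hq : 2 ≤ q) {a b i j : Fin k} (hij : i ≠ j) :
    coeff (Finsupp.single i q + Finsupp.single j 1) (X a ^ q * X b : MvPolynomial (Fin k) L) =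
      if a = i ∧ b = j then 1 else 0 := by
  rw [X_pow_eq_monomial, X, monomial_mul, coeff_monomial, one_mul]
  refine if_congr ⟨fun h => ?_, ?_⟩ rfl rfl
  · have hi := DFunLike.congr_fun h i
    have hj := DFunLike.congr_fun h j
    simp only [Finsupp.add_apply, Finsupp.single_apply, hij, hij.symm, if_true, if_false] at hi hj
    by_cases h1 : a = i
    · refine ⟨h1, ?_⟩
      subst h1
      by_contra h2
      simp [h2, hij] at hj
    · by_cases h2 : b = i
      · simp only [h1, h2, if_true, if_false] at hi
        omega
      · simp only [h1, h2, if_false] at hi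
        omega
  · rintro ⟨rfl, rfl⟩
    rfl

theorem formPoly_injective {q : ℕ} (hq : 2 ≤ q) :
    Function.Injective (formPoly L k q) := by
  rw [← LinearMap.ker_eq_bot, LinearMap.ker_eq_bot']
  intro ω hω
  rw [alternating_two_expand ω]
  refine Finset.sum_eq_zero ?_
  rintro ⟨i, j⟩ hij
  have hij' : i < j := by simpa using hij
  have h := congrArg (coeff (Finsupp.single i q + Finsupp.single j 1)) hω
  rw [formPoly_apply, coeff_sum, Finset.sum_eq_single (i, j)] at h
  · rw [coeff_smul, coeff_sub, coeff_X_pow_mul_X hq hij'.ne, mul_comm (X i) (X j ^ q),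
      coeff_X_pow_mul_X hq hij'.ne] at h
    simp only [hij'.ne, hij'.ne', and_self, if_true, if_false, sub_zero, smul_eq_mul, mul_one,
      coeff_zero] at h
    rw [h, zero_smul]
  · rintro ⟨a, b⟩ hab hne
    have hab' : a < b := by simpa using hab
    rw [coeff_smul, coeff_sub, coeff_X_pow_mul_X hq hij'.ne, mul_comm (X a) (X b ^ q),
      coeff_X_pow_mul_X hq hij'.ne, if_neg, if_neg, sub_zero, smul_zero]
    · rintro ⟨rfl, rfl⟩
      exact lt_asymm hab' hij'
    · rintro ⟨rfl, rfl⟩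
      exact hne rfl
  · intro hn
    exact absurd hij hn

theorem range_formPoly (K : Type*) [Field K] (s : ℕ) :
    LinearMap.range (formPoly L k (Nat.card K ^ s)) = formSpace K L k s := by
  apply le_antisymm
  · rintro _ ⟨ω, rfl⟩
    rw [formPoly_apply]
    refine Submodule.sum_mem _ fun p hp => Submodule.smul_mem _ _ (Submodule.subset_span ?_)
    exact ⟨p.1, p.2, by simpa using hp, rfl⟩
  · refine Submodule.span_le.2 ?_
    rintro _ ⟨i, j, hij, rfl⟩
    refine ⟨minorForm i j, ?_⟩
    rw [formPoly_apply, Finset.sum_eq_single (i, j)]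
    · simp [minorForm_apply, hij.ne, hij.ne']
    · rintro ⟨a, b⟩ hab hne
      have hab' : a < b := by simpa using hab
      have h1 : ¬ (i = a ∧ j = b) := fun h => hne (by rw [h.1, h.2])
      have h2 : ¬ (j = a ∧ i = b) := by
        rintro ⟨rfl, rfl⟩
        exact lt_asymm hab' hij
      have h0 : minorForm (L := L) i j ![Pi.single a 1, Pi.single b 1] = 0 := by
        rw [minorForm_apply]
        simp only [Pi.single_apply]
        by_cases hia : i = a <;> by_cases hjb : j = b <;> by_cases hja : j = a <;>
          by_cases hib : i = b <;> simp_all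
      rw [h0, zero_smul]
    · intro h
      exact absurd (by simpa using hij) h

end Polynomials

end RankMetric

namespace RankMetric

open MvPolynomial

/-! ### Vanishing on the linear set as a condition on the radical. -/

section VanishingForms

variable {K L : Type*} [Field K] [Field L] [Algebra K L] {k : ℕ}

/-- Evaluation at a point of `U` kills every generator of the ideal. Conversely, passing from `u` to
another representative `a • u` only multiplies the value by `a ^ q * a`. -/
theorem formPoly_mem_vanishingIdeal_iff {q : ℕ} (U : Submodule K (Fin k → L))
    (ω : (Fin k → L) [⋀^Fin 2]→ₗ[L] L) :
    formPoly L k q ω ∈ vanishingIdeal (linearSet K U) ↔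
      ∀ u ∈ U, ω ![fun i => u i ^ q, u] = 0 := by
  constructor
  · intro h u hu
    by_cases hu0 : u = 0
    · subst hu0
      exact ω.map_coord_zero (1 : Fin 2) rfl
    · rw [← eval_formPoly]
      have hle : vanishingIdeal (linearSet K U) ≤ RingHom.ker (eval u) := by
        refine Ideal.span_le.2 ?_
        rintro p ⟨-, hp⟩
        exact hp u hu0 ⟨u, hu, hu0, rfl⟩
      exact hle h
  · intro h
    refine Ideal.subset_span ⟨⟨q + 1, isHomogeneous_formPoly q ω⟩, ?_⟩
    rintro v hv ⟨u, hu, hu0, hvu⟩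
    obtain ⟨a, rfl⟩ := (Projectivization.mk_eq_mk_iff' L v u hv hu0).1 hvu
    rw [eval_formPoly, alternating_two_smul_right]
    have hpow : (fun i => (a • u) i ^ q) = a ^ q • fun i => u i ^ q := by
      ext i
      simp [mul_pow]
    rw [hpow, alternating_two_smul_left, h u hu, mul_zero, mul_zero]

/-- The `L`-span of the differences `w - σ(w)`, for `w ∈ U`. -/
def deviationSpace (σ : L ≃ₐ[K] L) (U : Submodule K (Fin k → L)) :
    Submodule L (Fin k → L) :=
  Submodule.span L {d | ∃ w ∈ U, d = w - fun i => σ (w i)}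

theorem vanishes_iff_mem_formsWithRadical (σ : L ≃ₐ[K] L) (U : Submodule K (Fin k → L))
    (hU : ∀ i : Fin k, Pi.single i 1 ∈ U) (ω : (Fin k → L) [⋀^Fin 2]→ₗ[L] L) :
    (∀ u ∈ U, ω ![fun i => σ (u i), u] = 0) ↔ ω ∈ formsWithRadical (deviationSpace σ U) := by
  constructor
  · intro h d hd x
    suffices hle : deviationSpace σ U ≤ LinearMap.ker (formLeft ω x) from hle hd
    refine Submodule.span_le.2 ?_
    rintro _ ⟨w, hw, rfl⟩
    suffices htop : formRight ω (w - fun i => σ (w i)) = 0 from LinearMap.congr_fun htop x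
    refine (Pi.basisFun L (Fin k)).ext fun i => ?_
    rw [Pi.basisFun_apply, LinearMap.zero_apply]
    change ω ![w - (fun i => σ (w i)), Pi.single i 1] = 0
    -- Polarization: `σ` fixes the unit vector `e_i`, so expanding at `e_i + w` leaves only the
    -- cross terms `ω(e_i, w) + ω(σ(w), e_i)`, that is `-ω(w - σ(w), e_i)`.
    have hadd := h _ (U.add_mem (hU i) hw)
    have hσ : (fun a => σ ((Pi.single i 1 + w : Fin k → L) a)) =
        Pi.single i 1 + fun a => σ (w a) := by
      ext a
      by_cases hai : a = i <;> simp [hai]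
    rw [hσ, alternating_two_add_left, alternating_two_add_right, alternating_two_add_right,
      alternating_two_self, h w hw, alternating_two_swap ω _ w] at hadd
    rw [alternating_two_sub_left]
    linear_combination -hadd
  · intro h u hu
    have hd := h _ (Submodule.subset_span ⟨u, hu, rfl⟩) u
    rw [alternating_two_sub_left, alternating_two_self] at hd
    linear_combination -hd

theorem finrank_formSpace_inf_vanishingIdeal (σ : L ≃ₐ[K] L) {s : ℕ}
    (hq : 2 ≤ Nat.card K ^ s) (hσ : ∀ x, σ x = x ^ Nat.card K ^ s)
    (U : Submodule K (Fin k → L)) (hU : ∀ i : Fin k, Pi.single i 1 ∈ U) :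
    Module.finrank L
        ↥(formSpace K L k s ⊓ (vanishingIdeal (linearSet K U)).restrictScalars L) =
      Nat.choose (k - Module.finrank L (deviationSpace σ U)) 2 := by
  have hmap : formSpace K L k s ⊓ (vanishingIdeal (linearSet K U)).restrictScalars L =
      (formsWithRadical (deviationSpace σ U)).map (formPoly L k (Nat.card K ^ s)) := by
    have hiff : ∀ ω, formPoly L k (Nat.card K ^ s) ω ∈ vanishingIdeal (linearSet K U) ↔
        ω ∈ formsWithRadical (deviationSpace σ U) := by
      intro ω
      rw [formPoly_mem_vanishingIdeal_iff, ← vanishes_iff_mem_formsWithRadical σ U hU]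
      simp only [hσ]
    ext p
    rw [Submodule.mem_inf, ← range_formPoly, Submodule.restrictScalars_mem, Submodule.mem_map]
    constructor
    · rintro ⟨⟨ω, rfl⟩, hp⟩
      exact ⟨ω, (hiff ω).1 hp, rfl⟩
    · rintro ⟨ω, hω, rfl⟩
      exact ⟨⟨ω, rfl⟩, (hiff ω).2 hω⟩
  rw [hmap, ← finrank_formsWithRadical]
  exact (Submodule.equivMapOfInjective _ (formPoly_injective hq) _).finrank_eq.symm

end VanishingForms

/-! ### The automorphism `σ` and its fixed field. -/

section FrobeniusPower

variable (K : Type*) {L : Type*} [Field K] [Finite K] [Field L] [Finite L] [Algebra K L]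

theorem exists_algEquiv_pow_card (s : ℕ) : ∃ σ : L ≃ₐ[K] L,
    (∀ x, σ x = x ^ Nat.card K ^ s) ∧
    (Nat.gcd s (Module.finrank K L) = 1 → ∀ x, σ x = x → x ∈ Set.range (algebraMap K L)) := by
  have := Fintype.ofFinite K
  have := Module.Finite.of_finite (R := K) (M := L)
  let φ := FiniteField.frobeniusAlgEquivOfAlgebraic K L
  refine ⟨φ ^ s, fun x => ?_, fun hs x hx => ?_⟩
  · rw [AlgEquiv.coe_pow, FiniteField.coe_frobeniusAlgEquivOfAlgebraic_iterate,
      Nat.card_eq_fintype_card]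
  · rw [IsGalois.mem_range_algebraMap_iff_fixed]
    intro f
    obtain ⟨a, rfl⟩ := (FiniteField.bijective_frobeniusAlgEquivOfAlgebraic_pow K L).2 f
    -- Since `s` is coprime to the order of the Frobenius, its `s`-th power still generates the
    -- Galois group.
    have hz : φ ∈ Subgroup.zpowers (φ ^ s) := by
      rw [mem_zpowers_pow_iff, FiniteField.orderOf_frobeniusAlgEquivOfAlgebraic]
      exact hs
    have hz' : φ ^ (a : ℕ) ∈ Subgroup.zpowers (φ ^ s) := Subgroup.pow_mem _ hz _
    have hle : Subgroup.zpowers (φ ^ s) ≤ MulAction.stabilizer (L ≃ₐ[K] L) x := by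
      rw [Subgroup.zpowers_le]
      exact hx
    exact hle hz'

end FrobeniusPower

/-! ### Subspaces stable under `σ`. -/

section StableSubspaces

variable {K L : Type*} [Field K] [Field L] [Algebra K L] {n : ℕ}

/-- Take a nonzero `w ∈ S` of minimal support with one entry scaled to 1. The vector `w - σ(w)` lies
in `S` and loses that entry from its support, so it is zero. -/
theorem exists_fixed_of_stable (σ : L ≃ₐ[K] L) (S : Submodule L (Fin n → L)) (hS : S ≠ ⊥)
    (hstable : ∀ v ∈ S, (fun j => σ (v j)) ∈ S) :
    ∃ v ∈ S, v ≠ 0 ∧ ∀ j, σ (v j) = v j := by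
  classical
  let supp : (Fin n → L) → ℕ := fun v => (Finset.univ.filter fun j => v j ≠ 0).card
  have hex : ∃ d, ∃ v ∈ S, v ≠ 0 ∧ supp v = d := by
    obtain ⟨v, hv, hv0⟩ := S.exists_mem_ne_zero_of_ne_bot hS
    exact ⟨_, v, hv, hv0, rfl⟩
  obtain ⟨v, hv, hv0, hd⟩ := Nat.find_spec hex
  obtain ⟨j₀, hj₀⟩ := Function.ne_iff.1 hv0
  have hj₀' : v j₀ ≠ 0 := hj₀
  refine ⟨(v j₀)⁻¹ • v, S.smul_mem _ hv, smul_ne_zero (inv_ne_zero hj₀') hv0, ?_⟩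
  set w := (v j₀)⁻¹ • v with hw
  have hwS : w ∈ S := S.smul_mem _ hv
  have hwj : w j₀ = 1 := by simp [hw, hj₀']
  by_contra! hne
  obtain ⟨j₁, hj₁⟩ := hne
  have hsub : w - (fun j => σ (w j)) ∈ S := S.sub_mem hwS (hstable w hwS)
  have hsub0 : w - (fun j => σ (w j)) ≠ 0 := by
    intro h
    have := congrFun h j₁
    simp only [Pi.sub_apply, Pi.zero_apply, sub_eq_zero] at this
    exact hj₁ this.symm
  refine Nat.find_min hex (m := supp (w - fun j => σ (w j))) ?_ ⟨_, hsub, hsub0, rfl⟩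
  rw [← hd]
  refine Finset.card_lt_card ?_
  rw [Finset.ssubset_iff_of_subset]
  · exact ⟨j₀, by simpa using hj₀', by simp [hwj]⟩
  · intro j hj
    simp only [Finset.mem_filter, Finset.mem_univ, true_and] at hj ⊢
    intro h0
    apply hj
    simp [hw, h0]

/-- At the first `t` where `σ^t(α)` depends on the earlier conjugates, the span of those `t`
conjugates is stable. -/
theorem exists_stable_of_not_linearIndependent (σ : L ≃ₐ[K] L) {α : Fin n → L} (hα : α ≠ 0)
    {k : ℕ} (h : ¬ LinearIndependent L fun i : Fin k => fun j => (σ ^ (i : ℕ)) (α j)) :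
    ∃ S : Submodule L (Fin n → L),
      S ≤ Submodule.span L (Set.range fun i : Fin k => fun j => (σ ^ (i : ℕ)) (α j)) ∧
      S ≠ ⊥ ∧ ∀ v ∈ S, (fun j => σ (v j)) ∈ S := by
  induction k with
  | zero => exact absurd linearIndependent_empty_type h
  | succ t ih =>
    by_cases ht : LinearIndependent L fun i : Fin t => fun j => (σ ^ (i : ℕ)) (α j)
    · rw [linearIndependent_finSucc'] at h
      have hlast : (fun j => (σ ^ t) (α j)) ∈
          Submodule.span L (Set.range fun i : Fin t => fun j => (σ ^ (i : ℕ)) (α j)) := by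
        by_contra hnot
        exact h ⟨ht, hnot⟩
      refine ⟨Submodule.span L (Set.range fun i : Fin t => fun j => (σ ^ (i : ℕ)) (α j)),
        ?_, ?_, ?_⟩
      · refine Submodule.span_mono ?_
        rintro _ ⟨i, rfl⟩
        exact ⟨i.castSucc, rfl⟩
      · have ht0 : t ≠ 0 := by
          rintro rfl
          rw [Set.range_eq_empty, Submodule.span_empty, Submodule.mem_bot] at hlast
          exact hα (by simpa using hlast)
        intro hbot
        have hmem : α ∈ Submodule.span L
            (Set.range fun i : Fin t => fun j => (σ ^ (i : ℕ)) (α j)) :=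
          Submodule.subset_span ⟨⟨0, Nat.pos_of_ne_zero ht0⟩, by simp⟩
        rw [hbot, Submodule.mem_bot] at hmem
        exact hα hmem
      · intro v hv
        induction hv using Submodule.span_induction with
        | mem x hx =>
          obtain ⟨i, rfl⟩ := hx
          have hnext : (fun j => σ ((σ ^ (i : ℕ)) (α j))) =
              fun j => (σ ^ ((i : ℕ) + 1)) (α j) := by
            ext j
            rw [pow_succ', AlgEquiv.mul_apply]
          rw [hnext]
          rcases Nat.lt_or_ge ((i : ℕ) + 1) t with hi | hi
          · exact Submodule.subset_span ⟨⟨i + 1, hi⟩, rfl⟩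
          · have : (i : ℕ) + 1 = t := by omega
            rw [this]
            exact hlast
        | zero =>
          convert Submodule.zero_mem _ using 1
          ext j
          simp
        | add x y _ _ hx hy =>
          convert Submodule.add_mem _ hx hy using 1
          ext j
          simp
        | smul c x _ hx =>
          convert Submodule.smul_mem _ (σ c) hx using 1
          ext j
          simp
    · obtain ⟨S, hle, hS⟩ := ih ht
      refine ⟨S, hle.trans (Submodule.span_mono ?_), hS⟩
      rintro _ ⟨i, rfl⟩
      exact ⟨i.castSucc, rfl⟩

end StableSubspaces

end RankMetric

namespace RankMetric

open Matrix

/-! ### MRD codes, their generator matrices and the deviation space. -/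

section Codes

variable {K L : Type*} [Field K] [Field L] [Algebra K L] {k n : ℕ}

theorem systematicMatrix_castLE (hkn : k ≤ n) (X : Matrix (Fin k) (Fin (n - k)) L)
    (i j : Fin k) :
    systematicMatrix hkn X i (Fin.castLE hkn j) = (1 : Matrix (Fin k) (Fin k) L) i j := by
  have hj : Fin.cast (Nat.add_sub_of_le hkn).symm (Fin.castLE hkn j) =
      finSumFinEquiv (Sum.inl j) := by
    ext
    simp
  rw [systematicMatrix, Matrix.submatrix_apply, hj, Equiv.symm_apply_apply]
  rfl

theorem vecMul_castLE {hkn : k ≤ n} {G : Matrix (Fin k) (Fin n) L}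
    (hG : ∀ i j, G i (Fin.castLE hkn j) = (1 : Matrix (Fin k) (Fin k) L) i j)
    (φ : Fin k → L) (a : Fin k) : (φ ᵥ* G) (Fin.castLE hkn a) = φ a := by
  simp [Matrix.vecMul, dotProduct, hG, Matrix.one_apply]

theorem IsGeneratorMatrix.mem_iff {G : Matrix (Fin k) (Fin n) L} {C : Submodule L (Fin n → L)}
    (hG : IsGeneratorMatrix G C) {v : Fin n → L} : v ∈ C ↔ ∃ φ, φ ᵥ* G = v := by
  rw [← hG.2, Submodule.mem_span_range_iff_exists_fun]
  simp only [Matrix.vecMul_eq_sum]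

theorem IsGeneratorMatrix.finrank_eq {G : Matrix (Fin k) (Fin n) L}
    {C : Submodule L (Fin n → L)} (hG : IsGeneratorMatrix G C) : Module.finrank L C = k := by
  rw [← hG.2, finrank_span_eq_card hG.1, Fintype.card_fin]

theorem IsMRD.le_rank {C : Submodule L (Fin n → L)} (hC : IsMRD K C) {v : Fin n → L}
    (hv : v ∈ C) (hv0 : v ≠ 0) :
    n + 1 ≤ Module.finrank L C + Module.finrank K (Submodule.span K (Set.range v)) := by
  have hle : minRankDist K C ≤ Module.finrank K (Submodule.span K (Set.range v)) := by
    refine Nat.sInf_le ⟨v, hv, 0, C.zero_mem, hv0, ?_⟩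
    have hsub : (fun j => v j - (0 : Fin n → L) j) = v := by
      ext j
      simp
    rw [rankDist, hsub]
  have := hC.2
  omega

/-- A nonzero word with entries in `K` has rank one, whereas the dimension being below `n` forces
minimum distance at least two. -/
theorem IsMRD.eq_zero_of_mem_range {C : Submodule L (Fin n → L)} (hC : IsMRD K C)
    (hlt : Module.finrank L C < n) {v : Fin n → L} (hv : v ∈ C)
    (hvK : ∀ j, v j ∈ Set.range (algebraMap K L)) : v = 0 := by
  by_contra hv0
  have hrank := hC.le_rank hv hv0
  have hle : Submodule.span K (Set.range v) ≤ Submodule.span K ({1} : Set L) := by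
    refine Submodule.span_le.2 ?_
    rintro _ ⟨j, rfl⟩
    obtain ⟨a, ha⟩ := hvK j
    exact Submodule.mem_span_singleton.2 ⟨a, by rw [← ha, Algebra.smul_def, mul_one]⟩
  have h1 := Submodule.finrank_mono hle
  have h2 := finrank_span_le_card (R := K) ({1} : Set L)
  simp at h2
  omega

/-- A relation involving column `j₀` would give a row of too small rank: `k - 1` of its entries
vanish in the identity block and the entry at `j₀` depends on the others, leaving rank at most `n -
k`. -/
theorem IsMRD.linearIndependent_columns {C : Submodule L (Fin n → L)} (hC : IsMRD K C)
    (hkn : k < n) {G : Matrix (Fin k) (Fin n) L} (hG : IsGeneratorMatrix G C)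
    (hk : 1 ≤ k)
    (hsys : ∀ i j, G i (Fin.castLE hkn.le j) = (1 : Matrix (Fin k) (Fin k) L) i j) :
    LinearIndependent K fun j => fun i => G i j := by
  classical
  rw [Fintype.linearIndependent_iff]
  intro c hc j₀
  by_contra hj₀
  -- If `j₀` lies in the identity block, row `i` must be the one with its 1 there, so that `j₀` is
  -- not among the `k - 1` zero positions; otherwise any row serves.
  obtain ⟨i, hi⟩ : ∃ i : Fin k, ∀ a : Fin k, Fin.castLE hkn.le a = j₀ → a = i := by
    by_cases h : ∃ a : Fin k, Fin.castLE hkn.le a = j₀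
    · obtain ⟨a, rfl⟩ := h
      exact ⟨a, fun b hb => Fin.castLE_injective _ hb⟩
    · exact ⟨⟨0, hk⟩, fun a ha => absurd ⟨a, ha⟩ h⟩
  let T : Finset (Fin n) :=
    ((Finset.univ.erase i).image (Fin.castLE hkn.le) ∪ {j₀})ᶜ
  have hT : T.card = n - k := by
    rw [Finset.card_compl, Fintype.card_fin, Finset.card_union_of_disjoint,
      Finset.card_image_of_injective _ (Fin.castLE_injective _),
      Finset.card_erase_of_mem (Finset.mem_univ _), Finset.card_fin, Finset.card_singleton]
    · congr 1
      omega
    · rw [Finset.disjoint_singleton_right]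
      intro hmem
      obtain ⟨a, ha, haj⟩ := Finset.mem_image.1 hmem
      exact (Finset.mem_erase.1 ha).1 (hi a haj)
  have hzero : ∀ j, j ∉ T → j ≠ j₀ → G i j = 0 := by
    intro j hj hne
    have hj' : j ∈ (Finset.univ.erase i).image (Fin.castLE hkn.le) := by
      simpa [T, hne] using hj
    obtain ⟨a, ha, rfl⟩ := Finset.mem_image.1 hj'
    rw [hsys, Matrix.one_apply_ne (Finset.mem_erase.1 ha).1.symm]
  have hmem : ∀ j ∈ T, G i j ∈ Submodule.span K (T.image (G i) : Set L) := fun j hj =>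
    Submodule.subset_span (by exact_mod_cast Finset.mem_image_of_mem _ hj)
  have hne : ∀ j, j ≠ j₀ → G i j ∈ Submodule.span K (T.image (G i) : Set L) := by
    intro j hj
    by_cases hjT : j ∈ T
    · exact hmem j hjT
    · rw [hzero j hjT hj]
      exact Submodule.zero_mem _
  have hlast : G i j₀ ∈ Submodule.span K (T.image (G i) : Set L) := by
    have hrow := congrFun hc i
    rw [Finset.sum_apply, ← Finset.add_sum_erase _ _ (Finset.mem_univ j₀)] at hrow
    have hsmul : c j₀ • G i j₀ ∈ Submodule.span K (T.image (G i) : Set L) := by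
      have : c j₀ • G i j₀ = -∑ j ∈ Finset.univ.erase j₀, c j • G i j :=
        eq_neg_of_add_eq_zero_left hrow
      rw [this]
      exact Submodule.neg_mem _ (Submodule.sum_mem _ fun j hj =>
        Submodule.smul_mem _ _ (hne j (Finset.mem_erase.1 hj).1))
    exact (Submodule.smul_mem_iff _ hj₀).1 hsmul
  have hspan : Submodule.span K (Set.range (G i)) ≤
      Submodule.span K (T.image (G i) : Set L) := by
    refine Submodule.span_le.2 ?_
    rintro _ ⟨j, rfl⟩
    by_cases hj : j = j₀
    · rw [hj]
      exact hlast
    · exact hne j hj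
  have h1 := Submodule.finrank_mono hspan
  have h2 := finrank_span_finset_le_card (R := K) (T.image (G i))
  have h3 : (T.image (G i)).card ≤ T.card := Finset.card_image_le
  have h4 := hC.le_rank (hG.2 ▸ Submodule.subset_span ⟨i, rfl⟩ : G i ∈ C) (hG.1.ne_zero i)
  rw [hG.finrank_eq] at h4
  rw [hT] at h3
  have h5 : Module.finrank K (Submodule.span K (Set.range (G i))) ≤ n - k :=
    h1.trans (h2.trans h3)
  omega

theorem single_mem_columnSystem {hkn : k ≤ n} {G : Matrix (Fin k) (Fin n) L}
    (hsys : ∀ i j, G i (Fin.castLE hkn j) = (1 : Matrix (Fin k) (Fin k) L) i j) (a : Fin k) :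
    Pi.single a 1 ∈ columnSystem K G := by
  refine Submodule.subset_span ⟨Fin.castLE hkn a, ?_⟩
  ext i
  simp [hsys, Matrix.one_apply, Pi.single_apply]

/-- The map `w ↦ w - σ(w)` is `K`-linear, so testing it on the columns suffices. -/
theorem deviationSpace_columnSystem_le (σ : L ≃ₐ[K] L) (G : Matrix (Fin k) (Fin n) L)
    (T : Submodule L (Fin k → L)) (hT : ∀ j, (fun i => G i j - σ (G i j)) ∈ T) :
    deviationSpace σ (columnSystem K G) ≤ T := by
  refine Submodule.span_le.2 ?_
  rintro _ ⟨w, hw, rfl⟩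
  change (w - fun i => σ (w i)) ∈ T
  induction hw using Submodule.span_induction with
  | mem x hx =>
    obtain ⟨j, rfl⟩ := hx
    exact hT j
  | zero =>
    have h0 : ((0 : Fin k → L) - fun i => σ ((0 : Fin k → L) i)) = 0 := by
      ext i
      simp
    rw [h0]
    exact T.zero_mem
  | add x y _ _ hx hy =>
    convert T.add_mem hx hy using 1
    ext i
    simp only [Pi.sub_apply, Pi.add_apply, map_add]
    ring
  | smul c x _ hx =>
    convert T.smul_mem (algebraMap K L c) hx using 1
    ext i
    simp [Algebra.smul_def, mul_sub]

theorem sub_mem_deviationSpace (σ : L ≃ₐ[K] L) (G : Matrix (Fin k) (Fin n) L) (j : Fin n) :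
    (fun i => G i j - σ (G i j)) ∈ deviationSpace σ (columnSystem K G) :=
  Submodule.subset_span ⟨fun i => G i j, Submodule.subset_span ⟨j, rfl⟩, rfl⟩

theorem IsMRD.deviationSpace_ne_bot {C : Submodule L (Fin n → L)} (hC : IsMRD K C)
    (hk : 1 ≤ k) (hkn : k < n) {G : Matrix (Fin k) (Fin n) L} (hG : IsGeneratorMatrix G C)
    {σ : L ≃ₐ[K] L} (hfix : ∀ x, σ x = x → x ∈ Set.range (algebraMap K L)) :
    deviationSpace σ (columnSystem K G) ≠ ⊥ := by
  intro hbot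
  refine hG.1.ne_zero ⟨0, hk⟩ (hC.eq_zero_of_mem_range (hG.finrank_eq.trans_lt hkn)
    (hG.2 ▸ Submodule.subset_span ⟨_, rfl⟩) fun j => hfix _ ?_)
  have hmem := sub_mem_deviationSpace σ G j
  rw [hbot, Submodule.mem_bot] at hmem
  exact (sub_eq_zero.1 (congrFun hmem _)).symm

theorem algEquiv_pow_apply {s : ℕ} {σ : L ≃ₐ[K] L} (hσ : ∀ x, σ x = x ^ Nat.card K ^ s)
    (i : ℕ) (x : L) : (σ ^ i) x = x ^ Nat.card K ^ (s * i) := by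
  induction i with
  | zero => simp
  | succ i ih =>
    rw [pow_succ', AlgEquiv.mul_apply, ih, hσ, ← pow_mul, ← pow_add]
    rfl

theorem map_vecMul_sub {σ : L ≃ₐ[K] L} (G : Matrix (Fin k) (Fin n) L) (φ : Fin k → L)
    (j : Fin n) : ((fun i => σ (φ i)) ᵥ* G) j - σ ((φ ᵥ* G) j) =
      (fun i => σ (φ i)) ⬝ᵥ fun i => G i j - σ (G i j) := by
  simp only [Matrix.vecMul, dotProduct, map_sum, map_mul, ← Finset.sum_sub_distrib, mul_sub]

/-- The identity block shows that the coordinate vectors of the conjugates of `α` are themselves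
conjugates, `φ (i + 1) = σ (φ i)`. By `map_vecMul_sub`, the `t` independent vectors `φ 1, …, φ t`
annihilate the deviation space in dimension `t + 1`. -/
theorem finrank_deviationSpace_le_one {t s : ℕ} {C : Submodule L (Fin n → L)}
    {hkn : t + 1 ≤ n} {G : Matrix (Fin (t + 1)) (Fin n) L} (hG : IsGeneratorMatrix G C)
    (hsys : ∀ i j, G i (Fin.castLE hkn j) =
      (1 : Matrix (Fin (t + 1)) (Fin (t + 1)) L) i j)
    {σ : L ≃ₐ[K] L} (hσ : ∀ x, σ x = x ^ Nat.card K ^ s)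
    (hgab : IsGeneralizedGabidulin K s (t + 1) C) :
    Module.finrank L (deviationSpace σ (columnSystem K G)) ≤ 1 := by
  obtain ⟨-, α, -, hZ⟩ := hgab
  let φ : Fin (t + 1) → Fin (t + 1) → L := fun i a => (σ ^ (i : ℕ)) (α (Fin.castLE hkn a))
  have hφ : ∀ i, φ i ᵥ* G = fun j => (σ ^ (i : ℕ)) (α j) := by
    intro i
    have hrow : (fun j => (σ ^ (i : ℕ)) (α j)) = gabidulinMatrix K s (t + 1) α i := by
      ext j
      exact algEquiv_pow_apply hσ i (α j)
    have hmem : (fun j => (σ ^ (i : ℕ)) (α j)) ∈ C := by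
      rw [hrow, ← hZ.2]
      exact Submodule.subset_span ⟨i, rfl⟩
    obtain ⟨ψ, hψ⟩ := hG.mem_iff.1 hmem
    have : φ i = ψ := by
      ext a
      rw [← vecMul_castLE hsys ψ a, hψ]
    rw [this, hψ]
  have hind : LinearIndependent L φ := by
    refine LinearIndependent.of_comp G.vecMulLinear ?_
    convert hZ.1 using 1
    ext i j
    change (φ i ᵥ* G) j = _
    rw [hφ]
    exact algEquiv_pow_apply hσ i (α j)
  let M : Matrix (Fin t) (Fin (t + 1)) L := Matrix.of fun i => φ i.succ
  have hM : M.rank = t := by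
    have : LinearIndependent L M.row := hind.comp Fin.succ (Fin.succ_injective _)
    rw [this.rank_matrix, Fintype.card_fin]
  have hle : deviationSpace σ (columnSystem K G) ≤ LinearMap.ker M.mulVecLin := by
    refine deviationSpace_columnSystem_le σ G _ fun j => ?_
    rw [LinearMap.mem_ker]
    ext i
    have hsucc : φ i.succ = fun a => σ (φ i.castSucc a) := by
      ext a
      simp only [φ, Fin.val_succ, Fin.val_castSucc, pow_succ', AlgEquiv.mul_apply]
    change φ i.succ ⬝ᵥ (fun a => G a j - σ (G a j)) = 0
    rw [hsucc, ← map_vecMul_sub, ← hsucc, hφ, hφ]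
    simp only [Fin.val_succ, Fin.val_castSucc, pow_succ', AlgEquiv.mul_apply, sub_self]
  have h1 := Submodule.finrank_mono hle
  have h2 := M.mulVecLin.finrank_range_add_finrank_ker
  rw [Module.finrank_fin_fun] at h2
  have h3 : Module.finrank L (LinearMap.range M.mulVecLin) = t := hM
  omega

/-- Undoing `σ ^ (i + 1)` in each condition gives `t` linear equations in `t + 1` unknowns. -/
theorem exists_conjugates_orthogonal (σ : L ≃ₐ[K] L) {t : ℕ} (c : Fin (t + 1) → L) :
    ∃ φ : Fin (t + 1) → L, φ ≠ 0 ∧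
      ∀ i < t, (fun a => (σ ^ (i + 1)) (φ a)) ⬝ᵥ c = 0 := by
  let M : Matrix (Fin t) (Fin (t + 1)) L := Matrix.of fun i a => (σ ^ ((i : ℕ) + 1))⁻¹ (c a)
  have hker : LinearMap.ker M.mulVecLin ≠ ⊥ :=
    LinearMap.ker_ne_bot_of_finrank_lt (by simp)
  obtain ⟨φ, hφ, hφ0⟩ := Submodule.exists_mem_ne_zero_of_ne_bot hker
  refine ⟨φ, hφ0, fun i hi => ?_⟩
  have h := congrArg (σ ^ (i + 1)) (congrFun (LinearMap.mem_ker.1 hφ) ⟨i, hi⟩)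
  have happ : ∀ x, (σ ^ (i + 1)) ((σ ^ (i + 1))⁻¹ x) = x := fun x =>
    (σ ^ (i + 1)).apply_symm_apply x
  simp only [Matrix.mulVecLin_apply, Matrix.mulVec, dotProduct, M, Matrix.of_apply, map_sum,
    map_mul, happ, Pi.zero_apply, map_zero] at h
  simpa only [dotProduct, mul_comm] using h

theorem IsMRD.isGeneralizedGabidulin {t s : ℕ} {C : Submodule L (Fin n → L)} (hC : IsMRD K C)
    (hgcd : Nat.gcd s (Module.finrank K L) = 1)
    (hkn : t + 1 < n) {G : Matrix (Fin (t + 1)) (Fin n) L} (hG : IsGeneratorMatrix G C)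
    (hsys : ∀ i j, G i (Fin.castLE hkn.le j) =
      (1 : Matrix (Fin (t + 1)) (Fin (t + 1)) L) i j)
    {σ : L ≃ₐ[K] L} (hσ : ∀ x, σ x = x ^ Nat.card K ^ s)
    (hfix : ∀ x, σ x = x → x ∈ Set.range (algebraMap K L))
    (hD : Module.finrank L (deviationSpace σ (columnSystem K G)) ≤ 1) :
    IsGeneralizedGabidulin K s (t + 1) C := by
  obtain ⟨c, hc⟩ := finrank_le_one_iff.1 hD
  obtain ⟨φ, hφ0, hφ⟩ := exists_conjugates_orthogonal σ (c : Fin (t + 1) → L)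
  set α : Fin n → L := φ ᵥ* G with hα
  have hdev : ∀ j, ∃ a : L, (fun i => G i j - σ (G i j)) = a • (c : Fin (t + 1) → L) := by
    intro j
    obtain ⟨a, ha⟩ := hc ⟨_, sub_mem_deviationSpace σ G j⟩
    exact ⟨a, (congrArg Subtype.val ha).symm⟩
  have hconj : ∀ i ≤ t, (fun a => (σ ^ i) (φ a)) ᵥ* G = fun j => (σ ^ i) (α j) := by
    intro i
    induction i with
    | zero => exact fun _ => rfl
    | succ i ih =>
      intro hi
      ext j
      have hs : ∀ x, (σ ^ (i + 1)) x = σ ((σ ^ i) x) := fun x => by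
        rw [pow_succ', AlgEquiv.mul_apply]
      obtain ⟨a, ha⟩ := hdev j
      have h := map_vecMul_sub (σ := σ) G (fun a => (σ ^ i) (φ a)) j
      have horth := hφ i (by omega)
      simp only [hs] at horth ⊢
      rw [ha, dotProduct_smul, horth, smul_zero, sub_eq_zero, ih (by omega)] at h
      exact h
  have hmem : ∀ i : Fin (t + 1), (fun j => (σ ^ (i : ℕ)) (α j)) ∈ C := fun i =>
    hG.mem_iff.2 ⟨_, hconj i (by omega)⟩
  have hα0 : α ≠ 0 := by
    intro h
    apply hφ0
    ext a
    rw [← vecMul_castLE hsys φ a, ← hα, h]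
    rfl
  have hspan : Submodule.span L
      (Set.range fun i : Fin (t + 1) => fun j => (σ ^ (i : ℕ)) (α j)) ≤ C := by
    refine Submodule.span_le.2 ?_
    rintro _ ⟨i, rfl⟩
    exact hmem i
  -- Dependence would put a nonzero stable subspace, hence a nonzero word over `K`, inside `C`.
  have hind : LinearIndependent L fun i : Fin (t + 1) => fun j => (σ ^ (i : ℕ)) (α j) := by
    by_contra hdep
    obtain ⟨S, hSle, hS0, hstable⟩ := exists_stable_of_not_linearIndependent σ hα0 hdep
    obtain ⟨v, hv, hv0, hvfix⟩ := exists_fixed_of_stable σ S hS0 hstable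
    exact hv0 (hC.eq_zero_of_mem_range (hG.finrank_eq.trans_lt hkn) (hspan (hSle hv))
      fun j => hfix _ (hvfix j))
  have hgab : (fun i => gabidulinMatrix K s (t + 1) α i) =
      fun i : Fin (t + 1) => fun j => (σ ^ (i : ℕ)) (α j) := by
    ext i j
    exact (algEquiv_pow_apply hσ i (α j)).symm
  have hspan_eq : Submodule.span L
      (Set.range fun i : Fin (t + 1) => fun j => (σ ^ (i : ℕ)) (α j)) = C := by
    refine Submodule.eq_of_le_of_finrank_eq hspan ?_
    rw [finrank_span_eq_card hind, Fintype.card_fin, hG.finrank_eq]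
  refine ⟨hgcd, α, ?_, ?_, ?_⟩
  · rw [Fintype.linearIndependent_iff]
    intro a ha
    have hcols := hC.linearIndependent_columns hkn hG (by omega) hsys
    rw [Fintype.linearIndependent_iff] at hcols
    refine hcols a ?_
    -- A `K`-relation on `α` passes to its conjugates and so to all of `C`; on the rows of `G` it
    -- becomes a relation among the columns.
    have hkill : ∀ v ∈ C, ∑ j, a j • v j = 0 := by
      intro v hv
      rw [← hspan_eq] at hv
      induction hv using Submodule.span_induction with
      | mem x hx =>
        obtain ⟨i, rfl⟩ := hx
        have := congrArg (σ ^ (i : ℕ)) ha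
        simpa only [map_sum, map_smul, map_zero] using this
      | zero => simp
      | add x y _ _ hx hy => simp [smul_add, Finset.sum_add_distrib, hx, hy]
      | smul b x _ hx =>
        simp only [Pi.smul_apply, smul_comm _ b, ← Finset.smul_sum, hx, smul_zero]
    ext i
    rw [Finset.sum_apply]
    exact hkill (G i) (hG.2 ▸ Submodule.subset_span ⟨i, rfl⟩)
  · rw [hgab]
    exact hind
  · rw [hgab]
    exact hspan_eq

end Codes

/-- Pascal's rule gives a gap of `k - 2 > 0` between `choose (k - 1) 2` and `choose (k - 2) 2`. For
`k = 2` both are zero and `r` is not determined. -/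
theorem eq_one_of_choose_sub_two {k r : ℕ} (hk : 3 ≤ k)
    (h : Nat.choose (k - r) 2 = Nat.choose (k - 1) 2) : r ≤ 1 := by
  by_contra! hr
  have h1 : Nat.choose (k - r) 2 ≤ Nat.choose (k - 2) 2 := Nat.choose_le_choose 2 (by omega)
  obtain ⟨l, rfl⟩ : ∃ l, k = l + 3 := ⟨k - 3, by omega⟩
  have h2 : Nat.choose (l + 2) 2 = Nat.choose (l + 1) 1 + Nat.choose (l + 1) 2 := rfl
  simp only [Nat.reduceSubDiff, Nat.choose_one_right] at h h1 h2
  omega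

end RankMetric

theorem mainTheorem6 {K L : Type*} [Field K] [Finite K] [Field L] [Finite L] [Algebra K L]
    (m n k s : ℕ) (hm : Module.finrank K L = m)
    (hk : 1 ≤ k) (hkn : k < n)
    (hs : 1 ≤ s) (hsm : s ≤ m - 1) (hgcd : Nat.gcd s m = 1)
    (C : Submodule L (Fin n → L)) (hC : RankMetric.IsMRD K C)
    (X : Matrix (Fin k) (Fin (n - k)) L) (G : Matrix (Fin k) (Fin n) L)
    (hGX : G = RankMetric.systematicMatrix hkn.le X)
    (hG : RankMetric.IsGeneratorMatrix G C) :
    (RankMetric.IsGeneralizedGabidulin K s k C →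
      Module.finrank L
        ↥(RankMetric.formSpace K L k s ⊓
          (RankMetric.vanishingIdeal
            (RankMetric.linearSet K (RankMetric.columnSystem K G))).restrictScalars L)
        = Nat.choose (k - 1) 2) ∧
    (k ≠ 2 →
      Module.finrank L
        ↥(RankMetric.formSpace K L k s ⊓
          (RankMetric.vanishingIdeal
            (RankMetric.linearSet K (RankMetric.columnSystem K G))).restrictScalars L)
        = Nat.choose (k - 1) 2 →
      RankMetric.IsGeneralizedGabidulin K s k C) := by
  obtain ⟨σ, hσ, hfix⟩ := RankMetric.exists_algEquiv_pow_card K (L := L) s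
  have hfix' := hfix (hm ▸ hgcd)
  have hsys : ∀ i j, G i (Fin.castLE hkn.le j) = (1 : Matrix (Fin k) (Fin k) L) i j := by
    rw [hGX]
    exact RankMetric.systematicMatrix_castLE hkn.le X
  have hq : 2 ≤ Nat.card K ^ s :=
    (Finite.one_lt_card (α := K)).trans_le (Nat.le_self_pow (by omega) _)
  rw [RankMetric.finrank_formSpace_inf_vanishingIdeal σ hq hσ _
    (RankMetric.single_mem_columnSystem hsys)]
  obtain ⟨t, rfl⟩ : ∃ t, k = t + 1 := ⟨k - 1, by omega⟩
  refine ⟨fun hgab => ?_, fun hk2 heq => ?_⟩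
  · have hle := RankMetric.finrank_deviationSpace_le_one hG hsys hσ hgab
    have hne := hC.deviationSpace_ne_bot hk hkn hG hfix'
    have hpos := Submodule.one_le_finrank_iff.2 hne
    rw [le_antisymm hle hpos]
  · refine hC.isGeneralizedGabidulin (hm ▸ hgcd) hkn hG hsys hσ hfix' ?_
    -- For `k = 1` the deviation space lies in a one-dimensional space, so the bound is automatic.
    rcases Nat.eq_zero_or_pos t with rfl | ht
    · exact (Submodule.finrank_le _).trans (by simp)
    · exact RankMetric.eq_one_of_choose_sub_two (by omega) heq
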